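/- Conventions. Let $\|\cdot\|$ be the Euclidean norm on $\mathbb{R}^d$. For $\mathcal{A}\subset\mathbb{R}^d$ and $x,x'\in\mathcal{A}$, let $\mathsf{d}_{\mathcal{A}}(x,x')$ be the infimum of the lengths of the continuous curves $\gamma:[0,1]\to\mathcal{A}$ with $\gamma(0)=x$ and $\gamma(1)=x'$, where the length of $\gamma$ is $\sup\sum_j\|\gamma(t_{j+1})-\gamma(t_j)\|$ over all finite increasing sequences $(t_j)$ in $[0,1]$. The medial axis of $\mathcal{A}$ is the set of points of $\mathbb{R}^d$ that have two or more closest points on $\mathcal{A}$, and the reach $\rho_{\mathcal{A}}\in[0,\infty]$ is the infimum of the distances between points of $\mathcal{A}$ and points of its medial axis ($\infty$ if the medial axis is empty). Points $x_1,\dots,x_n$ form an $(\varepsilon,1/2)$-net of $\mathcal{A}$ if they belong to $\mathcal{A}$, every point of $\mathcal{A}$ is within distance $\varepsilon$ of some $x_i$, and $\|x_i-x_j\|\ge\varepsilon/2$ for all $i\ne j$. Submanifolds are embedded. Statement. Let $\mathcal{M}\subset\mathbb{R}^d$ be a compact connected $k$-dimensional $C^2$ submanifold without boundary. There is a constant $C>0$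 that depends only on $\mathcal{M}$ such that the following holds for all $\varepsilon\le 1/C$ and all points $x_1,\dots,x_n$ (with $n$ arbitrary) that form an $(\varepsilon,1/2)$-net of $\mathcal{M}$. Let $\mathbb{S}$ be the class of all compact connected $k$-dimensional $C^2$ submanifolds of $\mathbb{R}^d$ without boundary of which $x_1,\dots,x_n$ is an $(\varepsilon,1/2)$-net, and let $r_{\max}:=\sup_{\mathcal{S}'\in\mathbb{S}}\rho_{\mathcal{S}'}$. Let $\mathcal{S}\in\mathbb{S}$ be any surface with $\rho_{\mathcal{S}}=r_{\max}$ if some surface of $\mathbb{S}$ has reach $r_{\max}$, and any surface of $\mathbb{S}$ with $\rho_{\mathcal{S}}\ge r_{\max}/2$ otherwise. Then, for all $x,x'\in\mathcal{M}\cap\mathcal{S}$, the distances $\mathsf{d}_{\mathcal{M}}(x,x')$ and $\mathsf{d}_{\mathcal{S}}(x,x')$ are finite and $$|\mathsf{d}_{\mathcal{M}}(x,x')-\mathsf{d}_{\mathcal{S}}(x,x')|\le C\varepsilon^2\min\{\mathsf{d}_{\mathcal{M}}(x,x'),\mathsf{d}_{\mathcal{S}}(x,x')\}.$$ In particular, the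 estimates $\hat d(x_i,x_j):=\mathsf{d}_{\mathcal{S}}(x_i,x_j)$ satisfy $$|\mathsf{d}_{\mathcal{M}}(x_i,x_j)-\hat d(x_i,x_j)|\le C\varepsilon^2\min\{\mathsf{d}_{\mathcal{M}}(x_i,x_j),\hat d(x_i,x_j)\}\quad\text{for all } i,j\in\{1,\dots,n\}.$$ -/

import Mathlib

open Set
open scoped ENNReal

noncomputable section

/-- `M` is a `k`-dimensional embedded `C²` submanifold, without boundary, of `ℝ^d`: around each of
its points there is a `C²` diffeomorphism `e` between open subsets of `ℝ^d` that straightens `M` to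
a `k`-dimensional linear subspace `W`. -/
def IsC2Submanifold {d : ℕ} (k : ℕ) (M : Set (EuclideanSpace ℝ (Fin d))) : Prop :=
  ∀ p ∈ M, ∃ (e : OpenPartialHomeomorph (EuclideanSpace ℝ (Fin d)) (EuclideanSpace ℝ (Fin d)))
    (W : Submodule ℝ (EuclideanSpace ℝ (Fin d))),
    p ∈ e.source ∧ Module.finrank ℝ W = k ∧
    ContDiffOn ℝ 2 e e.source ∧ ContDiffOn ℝ 2 e.symm e.target ∧
    ∀ x ∈ e.source, x ∈ M ↔ e x ∈ W

/-- A compact connected (in particular non-empty) `k`-dimensional `C²` submanifold of `ℝ^d` without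
boundary. -/
structure IsClosedC2Surface {d : ℕ} (k : ℕ) (M : Set (EuclideanSpace ℝ (Fin d))) : Prop where
  isCompact : IsCompact M
  isConnected : IsConnected M
  isC2Submanifold : IsC2Submanifold k M

/-- The medial axis: the points with two or more closest points on `M`. -/
def medialAxis {d : ℕ} (M : Set (EuclideanSpace ℝ (Fin d))) : Set (EuclideanSpace ℝ (Fin d)) :=
  {z | ∃ p ∈ M, ∃ q ∈ M, p ≠ q ∧ dist z p = Metric.infDist z M ∧ dist z q = Metric.infDist z M}

/-- The reach: the infimum of the distances between points of `M` and points of the medial axis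
(`∞` if the medial axis is empty). -/
def reach {d : ℕ} (M : Set (EuclideanSpace ℝ (Fin d))) : ℝ≥0∞ :=
  ⨅ p ∈ M, ⨅ z ∈ medialAxis M, edist p z

/-- The intrinsic distance on `M`, with values in `[0, ∞]`: the infimum of the lengths of the
continuous curves `γ : [0, 1] → M` from `p` to `q`. The length of a curve is its variation. -/
def intrinsicEDist {d : ℕ} (M : Set (EuclideanSpace ℝ (Fin d)))
    (p q : EuclideanSpace ℝ (Fin d)) : ℝ≥0∞ :=
  ⨅ (γ : ℝ → EuclideanSpace ℝ (Fin d))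
    (_ : ContinuousOn γ (Icc 0 1) ∧ MapsTo γ (Icc 0 1) M ∧ γ 0 = p ∧ γ 1 = q),
    eVariationOn γ (Icc 0 1)

/-- The intrinsic distance on `M` as a real number (meaningful where `intrinsicEDist` is finite). -/
def intrinsicDist {d : ℕ} (M : Set (EuclideanSpace ℝ (Fin d)))
    (p q : EuclideanSpace ℝ (Fin d)) : ℝ :=
  (intrinsicEDist M p q).toReal

/-- The family `x` is an `(ε, η)`-net of `M`: its points lie on `M`, every point of `M` is within
distance `ε` of one of them, and any two of them are at distance at least `η ε`. -/
structure IsNet {d n : ℕ} (x : Fin n → EuclideanSpace ℝ (Fin d)) (ε η : ℝ)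
    (M : Set (EuclideanSpace ℝ (Fin d))) : Prop where
  mem : ∀ i, x i ∈ M
  cover : ∀ p ∈ M, ∃ i, dist p (x i) ≤ ε
  separated : ∀ i j, i ≠ j → η * ε ≤ dist (x i) (x j)

/-- The class of compact connected `k`-dimensional `C²` submanifolds of `ℝ^d` without boundary of
which the sample `x` is an `(ε, 1/2)`-net. -/
def surfaceClass {d n : ℕ} (k : ℕ) (ε : ℝ) (x : Fin n → EuclideanSpace ℝ (Fin d)) :
    Set (Set (EuclideanSpace ℝ (Fin d))) :=
  {S | IsClosedC2Surface k S ∧ IsNet x ε (1 / 2) S}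

/-- The supremum of the reach over the class. -/
def maxReach {d n : ℕ} (k : ℕ) (ε : ℝ) (x : Fin n → EuclideanSpace ℝ (Fin d)) : ℝ≥0∞ :=
  ⨆ S ∈ surfaceClass k ε x, reach S

/-- `S` is a surface of the class that has maximal reach or, if no surface of the class attains the
supremum of the reach, whose reach is at least half of that supremum. -/
def IsReconstruction {d n : ℕ} (k : ℕ) (ε : ℝ) (x : Fin n → EuclideanSpace ℝ (Fin d))
    (S : Set (EuclideanSpace ℝ (Fin d))) : Prop :=
  S ∈ surfaceClass k ε x ∧
    (reach S = maxReach k ε x ∨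
      ((¬ ∃ S' ∈ surfaceClass k ε x, reach S' = maxReach k ε x) ∧ maxReach k ε x / 2 ≤ reach S))

end

open scoped Topology

/-! Both surfaces have touching balls of one radius `r` that depends only on `M`. Compactness and
the `C²` charts give `M` balls of some radius `2r`, hence reach at least `2r`. As `M` itself
competes in the class, `S` has reach at least `r`, and Federer's argument
(`two_mul_reach_mul_inner_le`) enlarges the touching balls of `S`, a priori of uncontrolled radius,
to radius `r`.

Touching balls make the deviation from tangent spaces quadratic, so two such surfaces through the
same `ε`-net lie within `η = 10ε²/r` of each other (`infDist_le_of_common_net`). They also make the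
closest-point projection Lipschitz with constant `r/(r-η) ≤ 1 + 2η/r` on the `η`-neighbourhood.
Projecting curves of one surface to the other fixes endpoints common to both and lengthens curves by
at most this factor, `1 + O(ε²)`; exchanging the roles gives the two-sided bound. -/

/-! ### Growth of the distance function below the reach -/

/-- The slope of the distance to a compact set at a point with a single closest point is `1`. -/
theorem infDist_add_smul_ge {d : ℕ} {M : Set (EuclideanSpace ℝ (Fin d))} (hM : IsCompact M)
    {x p : EuclideanSpace ℝ (Fin d)} (hp : p ∈ M) (hxp : dist x p = Metric.infDist x M)
    (hpos : 0 < Metric.infDist x M) (hx : x ∉ medialAxis M) {c : ℝ} (hc0 : 0 ≤ c) (hc : c < 1) :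
    ∃ σ > 0, ∀ t, 0 ≤ t → t ≤ σ → Metric.infDist x M + c * t ≤
      Metric.infDist (x + t • ((Metric.infDist x M)⁻¹ • (x - p))) M := by
  set δ := Metric.infDist x M with hδ
  set ν := δ⁻¹ • (x - p) with hν
  have hne : M.Nonempty := ⟨p, hp⟩
  have hnorm : ‖x - p‖ = δ := by rw [← dist_eq_norm, hxp]
  have hν1 : ‖ν‖ = 1 := by
    rw [hν, norm_smul, hnorm, norm_inv, Real.norm_of_nonneg hpos.le, inv_mul_cancel₀ hpos.ne']
  have hνp : inner ℝ ν (x - p) = δ := by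
    rw [hν, real_inner_smul_left, real_inner_self_eq_norm_sq, hnorm]
    field_simp
  -- Points of `M` away from the direction of `p` form a compact set that misses the unique closest
  -- point, so a gap separates their distances from `δ`. The distances to all other points grow at
  -- rate at least `c`.
  obtain ⟨σ, hσ, hfar⟩ : ∃ σ > 0, ∀ q ∈ M, inner ℝ ν (x - q) ≤ c * δ → δ + 2 * σ ≤ dist x q := by
    have hK : IsCompact (M ∩ {q | inner ℝ ν (x - q) ≤ c * δ}) :=
      hM.inter_right (isClosed_le (by fun_prop) continuous_const)
    rcases (M ∩ {q | inner ℝ ν (x - q) ≤ c * δ}).eq_empty_or_nonempty with h | h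
    · exact ⟨1, one_pos, fun q hq hq' => (h.subset ⟨hq, hq'⟩).elim⟩
    · obtain ⟨q, ⟨hqM, hq⟩, hmin⟩ := hK.exists_isMinOn h
        (f := fun q => dist x q) (by fun_prop)
      have hlt : δ < dist x q := by
        refine lt_of_le_of_ne (Metric.infDist_le_dist_of_mem hqM) fun heq => hx ?_
        refine ⟨p, hp, q, hqM, ?_, hxp, heq.symm⟩
        rintro rfl
        rw [mem_ofPred_eq, hνp] at hq
        nlinarith
      refine ⟨(dist x q - δ) / 2, by linarith, fun q' h1 h2 => ?_⟩
      have : dist x q ≤ dist x q' := hmin ⟨h1, h2⟩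
      linarith
  refine ⟨σ, hσ, fun t ht0 ht => (Metric.le_infDist hne).2 fun q hq => ?_⟩
  by_cases hcase : inner ℝ ν (x - q) ≤ c * δ
  · have h1 := hfar q hq hcase
    have h2 : dist x q ≤ dist x (x + t • ν) + dist (x + t • ν) q := dist_triangle _ _ _
    have h3 : dist x (x + t • ν) = t := by
      rw [dist_self_add_right, norm_smul, hν1, Real.norm_of_nonneg ht0, mul_one]
    nlinarith
  · push Not at hcase
    have h1 : δ ≤ ‖x - q‖ := by rw [← dist_eq_norm]; exact Metric.infDist_le_dist_of_mem hq
    have h2 : ‖x + t • ν - q‖ ^ 2 = ‖x - q‖ ^ 2 + 2 * (t * inner ℝ ν (x - q)) + t ^ 2 := by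
      rw [show x + t • ν - q = (x - q) + t • ν by abel, norm_add_sq_real, real_inner_smul_right,
        norm_smul, hν1, Real.norm_of_nonneg ht0, real_inner_comm, mul_one]
    rw [dist_eq_norm]
    refine abs_le_of_sq_le_sq' ?_ (norm_nonneg _) |>.2
    rw [h2]
    nlinarith [mul_le_mul_of_nonneg_left hcase.le ht0, sq_nonneg t, mul_nonneg hc0 ht0,
      mul_le_mul hc.le hc.le hc0 zero_le_one]

theorem notMem_medialAxis_of_infDist_lt_reach {d : ℕ} {M : Set (EuclideanSpace ℝ (Fin d))} {r : ℝ}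
    (hr : ENNReal.ofReal r ≤ reach M) {x : EuclideanSpace ℝ (Fin d)}
    (hx : Metric.infDist x M < r) : x ∉ medialAxis M := by
  intro hmem
  obtain ⟨p, hp, q, hq, hpq, hxp, hxq⟩ := hmem
  have h1 : ENNReal.ofReal r ≤ edist p x :=
    hr.trans (iInf₂_le_of_le p hp (iInf₂_le x ⟨p, hp, q, hq, hpq, hxp, hxq⟩))
  rw [edist_dist, ENNReal.ofReal_le_ofReal_iff dist_nonneg, dist_comm, hxp] at h1
  linarith

/-- Below the reach, the distance to `M` grows at full speed in some direction. -/
theorem exists_infDist_ge_add {d : ℕ} {M : Set (EuclideanSpace ℝ (Fin d))} (hM : IsCompact M)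
    (hne : M.Nonempty) {r : ℝ} (hr : ENNReal.ofReal r ≤ reach M) {x₀ : EuclideanSpace ℝ (Fin d)}
    (hpos : 0 < Metric.infDist x₀ M) {η : ℝ} (hη : 0 ≤ η) (hlt : Metric.infDist x₀ M + η < r) :
    ∃ x ∈ Metric.closedBall x₀ η, Metric.infDist x₀ M + η ≤ Metric.infDist x M := by
  have hB : IsCompact (Metric.closedBall x₀ η) := isCompact_closedBall _ _
  have hBne : (Metric.closedBall x₀ η).Nonempty := ⟨x₀, Metric.mem_closedBall_self hη⟩
  have key : ∀ c : ℝ, 0 ≤ c → c < 1 →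
      ∃ x ∈ Metric.closedBall x₀ η, Metric.infDist x₀ M + c * η ≤ Metric.infDist x M := by
    intro c hc0 hc
    -- A penalized maximum replaces the gradient flow of the distance: at a maximizer inside the
    -- ball, the slope `(c + 1) / 2 > c` would allow a further increase, so the maximizer lies on
    -- the sphere.
    obtain ⟨x, hxB, hmax⟩ := hB.exists_isMaxOn hBne
      (f := fun x => Metric.infDist x M - c * dist x x₀)
      ((Metric.continuous_infDist_pt M).sub (by fun_prop)).continuousOn
    have hx0 : Metric.infDist x₀ M - c * dist x₀ x₀ ≤ Metric.infDist x M - c * dist x x₀ :=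
      hmax (Metric.mem_closedBall_self hη)
    rw [dist_self, mul_zero, sub_zero] at hx0
    refine ⟨x, hxB, ?_⟩
    rcases (Metric.mem_closedBall.1 hxB).eq_or_lt with h | h
    · rw [h] at hx0; linarith
    exfalso
    have hdx : Metric.infDist x M < r := by
      have := Metric.infDist_le_infDist_add_dist (s := M) (x := x) (y := x₀)
      linarith
    have hxpos : 0 < Metric.infDist x M := by
      have := mul_nonneg hc0 (dist_nonneg (x := x) (y := x₀)); linarith
    obtain ⟨p, hp, hxp⟩ := hM.exists_infDist_eq_dist hne x
    obtain ⟨σ, hσ, hslope⟩ := infDist_add_smul_ge hM hp hxp.symm hxpos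
      (notMem_medialAxis_of_infDist_lt_reach hr hdx) (c := (c + 1) / 2) (by linarith) (by linarith)
    set ν := (Metric.infDist x M)⁻¹ • (x - p) with hν
    have hν1 : ‖ν‖ = 1 := by
      rw [hν, norm_smul, norm_inv, Real.norm_of_nonneg hxpos.le, ← dist_eq_norm, ← hxp,
        inv_mul_cancel₀ hxpos.ne']
    set t := min σ (η - dist x x₀) with ht
    have htpos : 0 < t := lt_min hσ (by linarith)
    have hs := hslope t htpos.le (min_le_left _ _)
    have hd : dist (x + t • ν) x₀ ≤ t + dist x x₀ := by
      refine (dist_triangle _ x _).trans (add_le_add_left ?_ _)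
      rw [dist_self_add_left, norm_smul, hν1, Real.norm_of_nonneg htpos.le, mul_one]
    have hin : x + t • ν ∈ Metric.closedBall x₀ η := by
      rw [Metric.mem_closedBall]
      have := min_le_right σ (η - dist x x₀)
      linarith
    have := hmax hin
    simp only [mem_ofPred_eq] at this
    nlinarith
  obtain ⟨x, hxB, hmax⟩ := hB.exists_isMaxOn hBne (f := fun x => Metric.infDist x M)
    (Metric.continuous_infDist_pt M).continuousOn
  refine ⟨x, hxB, ?_⟩
  have hall : ∀ c : ℝ, 0 ≤ c → c < 1 → Metric.infDist x₀ M + c * η ≤ Metric.infDist x M := by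
    intro c h0 h1
    obtain ⟨y, hy, hle⟩ := key c h0 h1
    exact hle.trans (hmax hy)
  by_contra! hcon
  rcases hη.eq_or_lt with h | h
  · subst h; have := hall 0 le_rfl one_pos; linarith
  · have h0 := hall 0 le_rfl one_pos
    -- The tested slope is the midpoint between the slope attained by the maximizer and `1`.
    have h1 := hall (((Metric.infDist x M - Metric.infDist x₀ M) / η + 1) / 2)
      (by have : 0 ≤ (Metric.infDist x M - Metric.infDist x₀ M) / η :=
            div_nonneg (by linarith) hη
          linarith)
      (by have : (Metric.infDist x M - Metric.infDist x₀ M) / η < 1 := by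
            rw [div_lt_one h]; linarith
          linarith)
    have h2 : (Metric.infDist x M - Metric.infDist x₀ M) / η * η =
      Metric.infDist x M - Metric.infDist x₀ M := div_mul_cancel₀ _ h.ne'
    nlinarith

/-! ### Touching balls and tangent spaces -/

/-- The ball of radius `t` that touches at `p`, with centre in the direction `n`, contains `q` not
in its interior. -/
theorem le_dist_add_smul_iff {E : Type*} [NormedAddCommGroup E] [InnerProductSpace ℝ E]
    {p q n : E} (hn : ‖n‖ = 1) {t : ℝ} (ht : 0 ≤ t) :
    t ≤ dist (p + t • n) q ↔ 2 * t * inner ℝ (q - p) n ≤ ‖q - p‖ ^ 2 := by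
  have h2 : ‖q - p - t • n‖ ^ 2 = ‖q - p‖ ^ 2 - 2 * t * inner ℝ (q - p) n + t ^ 2 := by
    rw [norm_sub_sq_real, real_inner_smul_right, norm_smul, hn, Real.norm_of_nonneg ht]
    ring
  rw [dist_comm, dist_eq_norm, show q - (p + t • n) = q - p - t • n by abel,
    ← abs_of_nonneg ht, ← abs_norm, ← sq_le_sq, abs_of_nonneg ht, h2]
  constructor <;> intro h <;> linarith

/-- Federer: if `p` is a closest point of `p + t n`, then the balls of radius up to the reach that
touch at `p` in the direction `n` have no point of `M` inside. -/
theorem two_mul_reach_mul_inner_le {d : ℕ} {M : Set (EuclideanSpace ℝ (Fin d))} (hM : IsCompact M)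
    {r : ℝ} (hr0 : 0 ≤ r) (hr : ENNReal.ofReal r ≤ reach M) {p n : EuclideanSpace ℝ (Fin d)} (hp : p ∈ M)
    (hn : ‖n‖ = 1) {t : ℝ} (ht : 0 < t) (h : ∀ q ∈ M, 2 * t * inner ℝ (q - p) n ≤ ‖q - p‖ ^ 2) :
    ∀ q ∈ M, 2 * r * inner ℝ (q - p) n ≤ ‖q - p‖ ^ 2 := by
  have hne : M.Nonempty := ⟨p, hp⟩
  intro q hq
  rcases le_total (inner ℝ (q - p) n) 0 with hneg | hi
  · nlinarith [sq_nonneg ‖q - p‖, mul_nonneg hr0 (neg_nonneg.2 hneg)]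
  rcases le_or_gt r t with hrt | hrt
  · have := h q hq
    nlinarith
  have hd0 : Metric.infDist (p + t • n) M = t := by
    apply le_antisymm
    · refine (Metric.infDist_le_dist_of_mem hp).trans ?_
      rw [dist_self_add_left, norm_smul, hn, Real.norm_of_nonneg ht.le, mul_one]
    · exact (Metric.le_infDist hne).2 fun q hq => (le_dist_add_smul_iff hn ht.le).2 (h q hq)
  have key : ∀ s, t ≤ s → s < r → 2 * s * inner ℝ (q - p) n ≤ ‖q - p‖ ^ 2 := by
    intro s hts hsr
    -- The point `x` is at distance at least `s` from `p`, yet within `s - t` of `p + t • n`.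
    -- Equality in the triangle inequality forces `x = p + s • n`.
    obtain ⟨x, hx, hle⟩ := exists_infDist_ge_add hM hne hr (x₀ := p + t • n) (by rw [hd0]; exact ht)
      (sub_nonneg.2 hts) (by rw [hd0]; linarith)
    rw [hd0, add_sub_cancel] at hle
    rw [Metric.mem_closedBall, dist_eq_norm] at hx
    set u := x - (p + t • n) with hu
    have hsp : s ≤ ‖t • n + u‖ := by
      rw [show t • n + u = x - p by rw [hu]; abel, ← dist_eq_norm]
      exact hle.trans (Metric.infDist_le_dist_of_mem hp)
    have hsq : ‖t • n + u‖ ^ 2 = t ^ 2 + 2 * t * inner ℝ u n + ‖u‖ ^ 2 := by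
      rw [norm_add_sq_real, real_inner_smul_left, norm_smul, hn, Real.norm_of_nonneg ht.le,
        real_inner_comm]
      ring
    have h1 : s ^ 2 ≤ ‖t • n + u‖ ^ 2 := by gcongr; linarith
    have h2 : ‖u‖ ^ 2 ≤ (s - t) ^ 2 := by gcongr
    have h3 : s - t ≤ inner ℝ u n := by
      by_contra! hlt
      nlinarith
    have h4 : ‖u - (s - t) • n‖ ^ 2 = ‖u‖ ^ 2 - 2 * (s - t) * inner ℝ u n + (s - t) ^ 2 := by
      rw [norm_sub_sq_real, real_inner_smul_right, norm_smul, hn,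
        Real.norm_of_nonneg (sub_nonneg.2 hts)]
      ring
    have h5 : ‖u - (s - t) • n‖ ^ 2 ≤ 0 := by
      rw [h4]; nlinarith [mul_le_mul_of_nonneg_left h3 (sub_nonneg.2 hts)]
    have h6 : u = (s - t) • n := by
      rw [← sub_eq_zero, ← norm_eq_zero]
      exact pow_eq_zero_iff two_ne_zero |>.1 (le_antisymm h5 (sq_nonneg _))
    have h7 : x = p + s • n := by
      rw [show x = u + (p + t • n) by rw [hu]; abel, h6, sub_smul]; abel
    rw [← le_dist_add_smul_iff hn (ht.le.trans hts), ← h7]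
    exact hle.trans (Metric.infDist_le_dist_of_mem hq)
  refine le_of_tendsto (f := fun s : ℝ => 2 * s * inner ℝ (q - p) n) (x := 𝓝[<] r) ?_ ?_
  · exact ((by fun_prop : Continuous fun s : ℝ => 2 * s * inner ℝ (q - p) n).tendsto r).mono_left
      nhdsWithin_le_nhds
  · filter_upwards [Ioo_mem_nhdsLT hrt] with s hs using key s hs.1.le hs.2

/-- `T` is a tangent space of `M` at `p`: each of its vectors is the velocity of a curve in `M`, and
the balls of radius `r` that touch at `p` in a direction normal to `T` have no point of `M`
inside. -/
structure IsTangentWithBalls {E : Type*} [NormedAddCommGroup E] [InnerProductSpace ℝ E] (r : ℝ)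
    (M : Set E) (p : E) (T : Submodule ℝ E) : Prop where
  exists_curve : ∀ v ∈ T, ∃ γ : ℝ → E, γ 0 = p ∧ (∀ᶠ t in 𝓝 0, γ t ∈ M) ∧ HasDerivAt γ v 0
  inner_le : ∀ n ∈ Tᗮ, ∀ q ∈ M, 2 * r * inner ℝ (q - p) n ≤ ‖n‖ * ‖q - p‖ ^ 2

theorem IsTangentWithBalls.mono {E : Type*} [NormedAddCommGroup E] [InnerProductSpace ℝ E]
    {r s : ℝ} {M : Set E} {p : E} {T : Submodule ℝ E} (h : IsTangentWithBalls r M p T)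
    (hs : 0 ≤ s) (hsr : s ≤ r) : IsTangentWithBalls s M p T := by
  refine ⟨h.exists_curve, fun n hn q hq => ?_⟩
  have h1 := h.inner_le n hn q hq
  rcases le_total (inner ℝ (q - p) n) 0 with h0 | h0
  · have : 0 ≤ ‖n‖ * ‖q - p‖ ^ 2 := by positivity
    nlinarith
  · nlinarith

/-- The gradient of a function that has a maximum over `M` at `p` is normal to `M`. -/
theorem IsTangentWithBalls.mem_orthogonal_of_isMaxOn {E : Type*} [NormedAddCommGroup E]
    [InnerProductSpace ℝ E] {r : ℝ} {M : Set E} {p : E} {T : Submodule ℝ E}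
    (h : IsTangentWithBalls r M p T) {φ : E → ℝ} {n : E}
    (hφ : HasFDerivAt φ (innerSL ℝ n) p) (hmax : IsMaxOn φ M p) : n ∈ Tᗮ := by
  rw [Submodule.mem_orthogonal']
  intro v hv
  obtain ⟨γ, h0, hM, hγ⟩ := h.exists_curve v hv
  subst h0
  have hd := hφ.comp_hasDerivAt (0 : ℝ) hγ
  have hloc : IsLocalMax (φ ∘ γ) 0 := by
    filter_upwards [hM] with t ht using hmax ht
  simpa using hloc.hasDerivAt_eq_zero hd

theorem hasFDerivAt_half_norm_sub_sq {E : Type*} [NormedAddCommGroup E] [InnerProductSpace ℝ E]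
    (x p : E) : HasFDerivAt (fun y : E => ‖y - x‖ ^ 2 / 2) (innerSL ℝ (p - x)) p := by
  have h := (((hasFDerivAt_id p).sub_const x).norm_sq).const_mul (1 / 2 : ℝ)
  refine (h.congr_fderiv ?_).congr_of_eventuallyEq (.of_forall fun y => ?_)
  · ext v
    simp
  · simp only [id]
    ring

/-- The segment from a closest point is normal to `M`. -/
theorem IsTangentWithBalls.sub_mem_orthogonal {E : Type*} [NormedAddCommGroup E]
    [InnerProductSpace ℝ E] {r : ℝ} {M : Set E} {p x : E} {T : Submodule ℝ E}
    (h : IsTangentWithBalls r M p T) (hx : dist x p = Metric.infDist x M) : x - p ∈ Tᗮ := by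
  refine h.mem_orthogonal_of_isMaxOn (φ := fun y => -(‖y - x‖ ^ 2 / 2)) ?_ fun q hq => ?_
  · refine (hasFDerivAt_half_norm_sub_sq x p).neg.congr_fderiv ?_
    ext v
    simp
  · have h1 : ‖p - x‖ ≤ ‖q - x‖ := by
      rw [← dist_eq_norm, ← dist_eq_norm, dist_comm p, dist_comm q, hx]
      exact Metric.infDist_le_dist_of_mem hq
    have h2 : ‖p - x‖ ^ 2 ≤ ‖q - x‖ ^ 2 := by gcongr
    simp only [mem_ofPred_eq]
    linarith

/-! ### Touching balls of compact `C²` submanifolds -/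

/-- Take for `T` the image of `W` under the derivative of the inverse chart. The first-order Taylor
remainder of the inverse chart is quadratic because its derivative is `L`-Lipschitz; the
`K`-Lipschitz chart turns this into `C = L * K ^ 2`, uniformly in the base point `y`. -/
theorem IsC2Submanifold.exists_tangent_near {d k : ℕ} {M : Set (EuclideanSpace ℝ (Fin d))}
    (hM : IsC2Submanifold k M) {p : EuclideanSpace ℝ (Fin d)} (hp : p ∈ M) :
    ∃ U ∈ 𝓝 p, ∃ C : ℝ, 0 ≤ C ∧ ∀ y ∈ U ∩ M, ∃ T : Submodule ℝ (EuclideanSpace ℝ (Fin d)),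
      (∀ v ∈ T, ∃ γ : ℝ → EuclideanSpace ℝ (Fin d),
        γ 0 = y ∧ (∀ᶠ t in 𝓝 0, γ t ∈ M) ∧ HasDerivAt γ v 0) ∧
      ∀ n ∈ Tᗮ, ∀ q ∈ U ∩ M, inner ℝ (q - y) n ≤ C * ‖n‖ * ‖q - y‖ ^ 2 := by
  obtain ⟨e, W, hpe, -, he, hg, hW⟩ := hM p hp
  set g := e.symm with hgdef
  have hgat : ∀ a ∈ e.target, ContDiffAt ℝ 2 g a := fun a ha =>
    (hg a ha).contDiffAt (e.open_target.mem_nhds ha)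
  have hpt : e p ∈ e.target := e.map_source hpe
  obtain ⟨K, s, hs, hK⟩ := ((he p hpe).contDiffAt (e.open_source.mem_nhds hpe)).of_le
    (one_le_two) |>.exists_lipschitzOnWith
  obtain ⟨L, t, ht, hL⟩ := ((hgat _ hpt).fderiv_right (m := 1) (by norm_num)).exists_lipschitzOnWith
  obtain ⟨ρ, hρ, hball⟩ := Metric.mem_nhds_iff.1
    (Filter.inter_mem ht (e.open_target.mem_nhds hpt))
  refine ⟨s ∩ (e.source ∩ e ⁻¹' Metric.ball (e p) ρ), Filter.inter_mem hs
    (Filter.inter_mem (e.open_source.mem_nhds hpe)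
      ((e.continuousAt hpe).preimage_mem_nhds (Metric.ball_mem_nhds _ hρ))), L * K ^ 2,
      by positivity, ?_⟩
  rintro y ⟨⟨hys, hye, hyb⟩, hyM⟩
  have hyt : e y ∈ e.target := e.map_source hye
  have hyW : e y ∈ W := (hW y hye).1 hyM
  have hgy : HasFDerivAt g (fderiv ℝ g (e y)) (e y) :=
    ((hgat _ hyt).differentiableAt two_ne_zero).hasFDerivAt
  refine ⟨W.map (fderiv ℝ g (e y) : _ →ₗ[ℝ] _), ?_, ?_⟩
  · rintro _ ⟨u, hu, rfl⟩
    have hline : HasDerivAt (fun t : ℝ => e y + t • u) u 0 := by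
      simpa using ((hasDerivAt_id (0 : ℝ)).smul_const u).const_add (e y)
    refine ⟨fun t => g (e y + t • u), by simp [hgdef, e.left_inv hye], ?_, ?_⟩
    · have hcont : ContinuousAt (fun t : ℝ => e y + t • u) 0 := hline.continuousAt
      have : e.target ∈ 𝓝 ((fun t : ℝ => e y + t • u) 0) := by
        simpa using e.open_target.mem_nhds hyt
      filter_upwards [hcont.preimage_mem_nhds this] with t ht
      refine (hW _ (e.map_target ht)).2 ?_
      rw [e.right_inv ht]
      exact W.add_mem hyW (W.smul_mem _ hu)
    · have h0 : HasFDerivAt g (fderiv ℝ g (e y)) ((fun t : ℝ => e y + t • u) 0) := by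
        simpa using hgy
      exact h0.comp_hasDerivAt (0 : ℝ) hline
  · rintro n hn q ⟨⟨hqs, hqe, hqb⟩, hqM⟩
    have hqW : e q ∈ W := (hW q hqe).1 hqM
    have hseg : segment ℝ (e y) (e q) ⊆ Metric.ball (e p) ρ :=
      (convex_ball (e p) ρ).segment_subset hyb hqb
    have hest : ‖g (e q) - g (e y) - fderiv ℝ g (e y) (e q - e y)‖ ≤
        (L * ‖e q - e y‖) * ‖e q - e y‖ := by
      refine Convex.norm_image_sub_le_of_norm_hasFDerivWithin_le' (s := segment ℝ (e y) (e q))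
        (f' := fderiv ℝ g) (fun z hz => ?_) (fun z hz => ?_) (convex_segment _ _)
        (left_mem_segment _ _ _) (right_mem_segment _ _ _)
      · exact ((hgat _ (hball (hseg hz)).2).differentiableAt
          two_ne_zero).hasFDerivAt.hasFDerivWithinAt
      · rw [← dist_eq_norm]
        refine (hL.dist_le_mul _ (hball (hseg hz)).1 _ (hball hyb).1).trans ?_
        gcongr
        rw [dist_eq_norm]
        exact norm_sub_le_of_mem_segment hz
    rw [hgdef, e.left_inv hqe, e.left_inv hye] at hest
    have hperp : inner ℝ (fderiv ℝ g (e y) (e q - e y)) n = 0 :=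
      (Submodule.mem_orthogonal _ _).1 hn _ ⟨_, W.sub_mem hqW hyW, rfl⟩
    have hKd : ‖e q - e y‖ ≤ K * ‖q - y‖ := by
      simpa [dist_eq_norm] using hK.dist_le_mul q hqs y hys
    calc inner ℝ (q - y) n = inner ℝ (q - y - fderiv ℝ g (e y) (e q - e y)) n := by
          rw [inner_sub_left (q - y), hperp, sub_zero]
      _ ≤ ‖q - y - fderiv ℝ g (e y) (e q - e y)‖ * ‖n‖ := real_inner_le_norm _ _
      _ ≤ (L * (K * ‖q - y‖) * (K * ‖q - y‖)) * ‖n‖ := by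
          gcongr
          refine hest.trans ?_
          gcongr
      _ = _ := by ring

/-- A compact `C²` submanifold has tangent spaces with touching balls of a uniform radius. -/
theorem IsC2Submanifold.exists_tangentWithBalls {d k : ℕ} {M : Set (EuclideanSpace ℝ (Fin d))}
    (hM : IsC2Submanifold k M) (hc : IsCompact M) :
    ∃ r > 0, ∀ p ∈ M, ∃ T, IsTangentWithBalls r M p T := by
  -- The doubled membership puts the claim in a form that restricts to arbitrary sets, as compact
  -- induction requires.
  suffices h : ∃ r > 0, ∀ p ∈ M, p ∈ M → ∃ T, IsTangentWithBalls r M p T by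
    obtain ⟨r, hr, h⟩ := h
    exact ⟨r, hr, fun p hp => h p hp hp⟩
  refine hc.induction_on (p := fun s => ∃ r > 0, ∀ p ∈ s, p ∈ M → ∃ T, IsTangentWithBalls r M p T)
    ⟨1, one_pos, by simp⟩ ?_ ?_ ?_
  · rintro s t hst ⟨r, hr, h⟩
    exact ⟨r, hr, fun p hp => h p (hst hp)⟩
  · rintro s t ⟨r, hr, h⟩ ⟨r', hr', h'⟩
    refine ⟨min r r', lt_min hr hr', ?_⟩
    rintro p (hp | hp) hpM
    · obtain ⟨T, hT⟩ := h p hp hpM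
      exact ⟨T, hT.mono (lt_min hr hr').le (min_le_left _ _)⟩
    · obtain ⟨T, hT⟩ := h' p hp hpM
      exact ⟨T, hT.mono (lt_min hr hr').le (min_le_right _ _)⟩
  · intro p hp
    obtain ⟨U, hU, C, hC, h⟩ := hM.exists_tangent_near hp
    obtain ⟨δ, hδ, hball⟩ := Metric.mem_nhds_iff.1 hU
    refine ⟨Metric.ball p (δ / 2), mem_nhdsWithin_of_mem_nhds (Metric.ball_mem_nhds _ (half_pos hδ)),
      1 / (2 * (C + 2 / δ)), by positivity, fun y hy hyM => ?_⟩
    have hyδ : dist y p < δ / 2 := hy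
    obtain ⟨T, hT, hb⟩ := h y ⟨hball (Metric.ball_subset_ball (by linarith) hy), hyM⟩
    refine ⟨T, hT, fun n hn q hq => ?_⟩
    -- Near points obey the chart estimate; for far ones `‖q - y‖ ≥ δ / 2` makes Cauchy–Schwarz
    -- quadratic at the cost of `2 / δ`.
    have key : inner ℝ (q - y) n ≤ (C + 2 / δ) * (‖n‖ * ‖q - y‖ ^ 2) := by
      have hδn : 0 ≤ 2 / δ * (‖n‖ * ‖q - y‖ ^ 2) := by positivity
      by_cases hqb : q ∈ Metric.ball p δ
      · have := hb n hn q ⟨hball hqb, hq⟩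
        linarith
      · rw [Metric.mem_ball, not_lt] at hqb
        have h1 : δ / 2 ≤ ‖q - y‖ := by
          rw [← dist_eq_norm]
          linarith [dist_triangle q y p]
        have h2 : 1 ≤ 2 / δ * ‖q - y‖ := by
          rw [div_mul_eq_mul_div, le_div_iff₀ hδ]; linarith
        have h3 : 0 ≤ C * (‖n‖ * ‖q - y‖ ^ 2) := by positivity
        calc inner ℝ (q - y) n ≤ ‖q - y‖ * ‖n‖ * 1 := by
              rw [mul_one]; exact real_inner_le_norm _ _
          _ ≤ ‖q - y‖ * ‖n‖ * (2 / δ * ‖q - y‖) := by gcongr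
          _ ≤ _ := by linarith
    have hpos : 0 < C + 2 / δ := by positivity
    rw [show 2 * (1 / (2 * (C + 2 / δ))) * inner ℝ (q - y) n = inner ℝ (q - y) n / (C + 2 / δ) by
      field_simp, div_le_iff₀ hpos]
    linarith

/-- Touching balls bound the reach from below. -/
theorem ofReal_le_reach {d : ℕ} {M : Set (EuclideanSpace ℝ (Fin d))} {r : ℝ}
    (h : ∀ p ∈ M, ∃ T, IsTangentWithBalls r M p T) : ENNReal.ofReal r ≤ reach M := by
  refine le_iInf₂ fun p' hp' => le_iInf₂ fun z hz => ?_
  obtain ⟨p, hp, q, hq, hpq, hzp, hzq⟩ := hz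
  have hz : Metric.infDist z M ≤ dist p' z := by
    rw [dist_comm]; exact Metric.infDist_le_dist_of_mem hp'
  obtain ⟨T, hT⟩ := h p hp
  have h1 := hT.inner_le _ (hT.sub_mem_orthogonal hzp) q hq
  have h2 : ‖z - q‖ = ‖z - p‖ := by rw [← dist_eq_norm, ← dist_eq_norm, hzp, hzq]
  have h3 : ‖z - q‖ ^ 2 = ‖z - p‖ ^ 2 - 2 * inner ℝ (q - p) (z - p) + ‖q - p‖ ^ 2 := by
    rw [show z - q = (z - p) - (q - p) by abel, norm_sub_sq_real, real_inner_comm]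
  have h4 : 0 < ‖q - p‖ := norm_pos_iff.2 (sub_ne_zero.2 hpq.symm)
  rw [edist_dist]
  refine ENNReal.ofReal_le_ofReal (le_trans ?_ hz)
  rw [← hzp, dist_eq_norm]
  rw [h2] at h3
  have h5 : r * ‖q - p‖ ^ 2 ≤ ‖z - p‖ * ‖q - p‖ ^ 2 := by
    calc r * ‖q - p‖ ^ 2 = 2 * r * inner ℝ (q - p) (z - p) := by
          rw [show ‖q - p‖ ^ 2 = 2 * inner ℝ (q - p) (z - p) by linarith]; ring
      _ ≤ _ := h1
  exact le_of_mul_le_mul_right h5 (by positivity)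

/-- The touching balls of a compact `C²` submanifold may have any radius up to the reach. -/
theorem IsC2Submanifold.exists_tangentWithBalls_of_le_reach {d k : ℕ}
    {M : Set (EuclideanSpace ℝ (Fin d))} (hM : IsC2Submanifold k M) (hc : IsCompact M) {r : ℝ}
    (hr0 : 0 ≤ r) (hr : ENNReal.ofReal r ≤ reach M) :
    ∀ p ∈ M, ∃ T, IsTangentWithBalls r M p T := by
  obtain ⟨t, ht, h⟩ := hM.exists_tangentWithBalls hc
  intro p hp
  obtain ⟨T, hT⟩ := h p hp
  refine ⟨T, hT.exists_curve, fun n hn q hq => ?_⟩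
  rcases eq_or_ne n 0 with rfl | hn0
  · simp
  have hnpos : 0 < ‖n‖ := norm_pos_iff.2 hn0
  have hinner : ∀ q, inner ℝ (q - p) (‖n‖⁻¹ • n) = ‖n‖⁻¹ * inner ℝ (q - p) n := fun q =>
    real_inner_smul_right _ _ _
  have h1 := two_mul_reach_mul_inner_le hc hr0 hr hp (n := ‖n‖⁻¹ • n)
    (by rw [norm_smul, norm_inv, norm_norm, inv_mul_cancel₀ hnpos.ne']) ht (fun q hq => by
      have := hT.inner_le n hn q hq
      rw [hinner, ← mul_le_mul_iff_right₀ hnpos]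
      refine le_trans (le_of_eq ?_) this
      field_simp) q hq
  rw [hinner, ← mul_le_mul_iff_right₀ hnpos] at h1
  refine le_trans (le_of_eq ?_) h1
  field_simp

/-! ### Lipschitz projection -/

/-- The closest point map of a set with touching balls of radius `r` is Lipschitz near the set. -/
theorem norm_sub_le_of_tangentWithBalls {E : Type*} [NormedAddCommGroup E]
    [InnerProductSpace ℝ E] {r : ℝ} {M : Set E} (h : ∀ p ∈ M, ∃ T, IsTangentWithBalls r M p T)
    {η : ℝ} {x x' p p' : E} (hp : p ∈ M) (hp' : p' ∈ M)
    (hxp : dist x p = Metric.infDist x M) (hxp' : dist x' p' = Metric.infDist x' M)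
    (hx : Metric.infDist x M ≤ η) (hx' : Metric.infDist x' M ≤ η) (hr : 0 ≤ r) :
    (r - η) * ‖p - p'‖ ≤ r * ‖x - x'‖ := by
  obtain ⟨T, hT⟩ := h p hp
  obtain ⟨T', hT'⟩ := h p' hp'
  have h1 := hT.inner_le _ (hT.sub_mem_orthogonal hxp) p' hp'
  have h2 := hT'.inner_le _ (hT'.sub_mem_orthogonal hxp') p hp
  rw [norm_sub_rev p' p, ← dist_eq_norm x p, hxp] at h1
  rw [← dist_eq_norm x' p', hxp'] at h2
  -- Adding the two touching-ball inequalities leaves `‖p - p'‖ ^ 2` against `inner ℝ (p - p') (x -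
  -- x')`.
  have h3 : inner ℝ (p' - p) (x - p) + inner ℝ (p - p') (x' - p') =
      ‖p - p'‖ ^ 2 - inner ℝ (p - p') (x - x') := by
    rw [← real_inner_self_eq_norm_sq, ← neg_sub p p', inner_neg_left, ← inner_sub_right,
      neg_add_eq_sub, ← inner_sub_right]
    congr 1
    abel
  have h4 := mul_le_mul_of_nonneg_left (real_inner_le_norm (p - p') (x - x')) hr
  have h5 := mul_le_mul_of_nonneg_right hx (sq_nonneg ‖p - p'‖)
  have h6 := mul_le_mul_of_nonneg_right hx' (sq_nonneg ‖p - p'‖)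
  rcases (norm_nonneg (p - p')).eq_or_lt with h0 | h0
  · rw [← h0, mul_zero]; positivity
  refine le_of_mul_le_mul_left (a := ‖p - p'‖) ?_ h0
  have h7 : 2 * r * (inner ℝ (p' - p) (x - p) + inner ℝ (p - p') (x' - p')) ≤
    2 * η * ‖p - p'‖ ^ 2 := by linarith
  rw [h3] at h7
  linarith

theorem exists_lipschitzOnWith_retraction {E : Type*} [NormedAddCommGroup E]
    [InnerProductSpace ℝ E] {r : ℝ} {M : Set E} (h : ∀ p ∈ M, ∃ T, IsTangentWithBalls r M p T)
    (hM : IsCompact M) (hne : M.Nonempty) (hr : 0 ≤ r) {η : ℝ} (hη : η < r) :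
    ∃ π : E → E, (∀ x, π x ∈ M) ∧ (∀ x ∈ M, π x = x) ∧
      LipschitzOnWith (r / (r - η)).toNNReal π {x | Metric.infDist x M ≤ η} := by
  choose π hπ hd using hM.exists_infDist_eq_dist hne
  refine ⟨π, hπ, fun x hx => ?_, LipschitzOnWith.of_dist_le_mul fun x hx y hy => ?_⟩
  · have := hd x
    rw [Metric.infDist_zero_of_mem hx] at this
    exact (dist_eq_zero.1 this.symm).symm
  · have := norm_sub_le_of_tangentWithBalls h (hπ x) (hπ y) (hd x).symm (hd y).symm hx hy hr
    have hpos : 0 < r - η := sub_pos.2 hη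
    rw [Real.coe_toNNReal _ (by positivity), dist_eq_norm, dist_eq_norm, div_mul_eq_mul_div,
      le_div_iff₀ hpos]
    linarith

/-! ### Quadratic closeness from a common net -/

/-- Two compact sets with touching balls of radius `r` that share an `ε`-net are `O(ε²)`-close. -/
theorem infDist_le_of_common_net {d n : ℕ} {r ε η : ℝ} {M S : Set (EuclideanSpace ℝ (Fin d))}
    (hr : 0 < r) (hM : ∀ p ∈ M, ∃ T, IsTangentWithBalls r M p T)
    (hS : ∀ p ∈ S, ∃ T, IsTangentWithBalls r S p T) (hMc : IsCompact M) (hSc : IsCompact S)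
    {x : Fin n → EuclideanSpace ℝ (Fin d)} (hxM : IsNet x ε η M) (hxS : IsNet x ε η S)
    {s : EuclideanSpace ℝ (Fin d)} (hs : s ∈ S) : Metric.infDist s M ≤ 10 * ε ^ 2 / r := by
  obtain ⟨i, hi⟩ := hxS.cover s hs
  have hε : 0 ≤ ε := dist_nonneg.trans hi
  have hdε : Metric.infDist s M ≤ ε := (Metric.infDist_le_dist_of_mem (hxM.mem i)).trans hi
  obtain ⟨q, hq, hsq⟩ := hMc.exists_infDist_eq_dist ⟨_, hxM.mem i⟩ s
  set δ := Metric.infDist s M with hδ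
  rcases (Metric.infDist_nonneg (x := s) (s := M)).eq_or_lt with h0 | hpos
  · rw [hδ, ← h0]; positivity
  rw [← hδ] at hpos
  set ν := δ⁻¹ • (s - q) with hν
  have hnorm : ‖s - q‖ = δ := by rw [← dist_eq_norm, hsq]
  have hν1 : ‖ν‖ = 1 := by
    rw [hν, norm_smul, hnorm, norm_inv, Real.norm_of_nonneg hpos.le, inv_mul_cancel₀ hpos.ne']
  have hνs : inner ℝ (s - q) ν = δ := by
    rw [hν, real_inner_smul_right, real_inner_self_eq_norm_sq, hnorm]
    field_simp
  -- At `s` the direction `ν` need not be normal to `S`. The penalized maximizer `y` is a point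
  -- where `ν`, corrected by a multiple of `y - s`, is normal; no comparison of tangent spaces is
  -- needed.
  obtain ⟨y, hy, hmax⟩ := hSc.exists_isMaxOn ⟨s, hs⟩
    (f := fun y => inner ℝ ν y - 4 / r * (‖y - s‖ ^ 2 / 2)) (by fun_prop)
  obtain ⟨T, hT⟩ := hS y hy
  have hn : ν - (4 / r) • (y - s) ∈ Tᗮ := by
    refine hT.mem_orthogonal_of_isMaxOn ?_ hmax
    refine ((innerSL ℝ ν).hasFDerivAt.sub
      ((hasFDerivAt_half_norm_sub_sq s y).const_mul (4 / r))).congr_fderiv ?_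
    ext v
    simp
  set m := ν - (4 / r) • (y - s) with hm
  set u := ‖y - s‖ with hu
  have hu0 : 0 ≤ u := norm_nonneg _
  have hys : 2 / r * u ^ 2 ≤ inner ℝ (y - s) ν := by
    have : inner ℝ ν s - 4 / r * (‖s - s‖ ^ 2 / 2) ≤ inner ℝ ν y - 4 / r * (u ^ 2 / 2) := hmax hs
    rw [sub_self, norm_zero] at this
    rw [real_inner_comm, inner_sub_right]
    linarith [show 4 / r * (u ^ 2 / 2) = 2 / r * u ^ 2 by ring]
  have hur : u ≤ r / 2 := by
    have h1 : inner ℝ (y - s) ν ≤ u := by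
      simpa [hν1] using real_inner_le_norm (y - s) ν
    have h2 : 2 / r * u ^ 2 ≤ u := hys.trans h1
    rw [div_mul_eq_mul_div, div_le_iff₀ hr] at h2
    by_contra! hlt
    nlinarith
  have hm3 : ‖m‖ ≤ 3 := by
    have : ‖(4 / r) • (y - s)‖ ≤ 2 := by
      rw [norm_smul, Real.norm_of_nonneg (by positivity), div_mul_eq_mul_div, div_le_iff₀ hr]
      linarith
    linarith [norm_sub_le ν ((4 / r) • (y - s))]
  obtain ⟨j, hj⟩ := hxS.cover y hy
  rw [dist_comm, dist_eq_norm] at hj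
  have h1 : 2 * r * inner ℝ (x j - y) (-m) ≤ 3 * ε ^ 2 := by
    refine (hT.inner_le _ (Tᗮ.neg_mem hn) _ (hxS.mem j)).trans ?_
    rw [norm_neg]
    gcongr
  have h2 : inner ℝ (x j - y) ν = -inner ℝ (x j - y) (-m) + 4 / r * inner ℝ (x j - y) (y - s) := by
    rw [inner_neg_right, neg_neg, hm, inner_sub_right _ ν, real_inner_smul_right _ (y - s)]
    ring
  have h3 : -(ε * u) ≤ inner ℝ (x j - y) (y - s) := by
    have := (abs_le.1 (abs_real_inner_le_norm (x j - y) (y - s))).1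
    have : ‖x j - y‖ * ‖y - s‖ ≤ ε * u := by gcongr
    linarith
  -- The net point `x j` also lies on `M`, so the touching ball of `M` at `q` bounds its height from
  -- above, while `h1` bounds it from below through `S`.
  have h4 : 2 * r * inner ℝ (x j - q) ν ≤ (u + 2 * ε) ^ 2 := by
    obtain ⟨T', hT'⟩ := hM q hq
    have hmem : ν ∈ T'ᗮ := T'ᗮ.smul_mem _ (hT'.sub_mem_orthogonal hsq.symm)
    refine (hT'.inner_le ν hmem _ (hxM.mem j)).trans ?_
    rw [hν1, one_mul]
    gcongr
    calc ‖x j - q‖ = ‖(x j - y) + (y - s) + (s - q)‖ := by congr 1; abel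
      _ ≤ ‖x j - y‖ + ‖y - s‖ + ‖s - q‖ := norm_add₃_le
      _ ≤ u + 2 * ε := by rw [hnorm]; linarith
  have h5 : inner ℝ (x j - q) ν = inner ℝ (x j - y) ν + inner ℝ (y - s) ν + δ := by
    rw [← hνs, ← inner_add_left, ← inner_add_left]
    congr 1
    abel
  rw [le_div_iff₀ hr]
  have h6 : 2 * r * (4 / r * inner ℝ (x j - y) (y - s)) = 8 * inner ℝ (x j - y) (y - s) := by
    field_simp; ring
  have h7 : 2 * r * (2 / r * u ^ 2) = 4 * u ^ 2 := by field_simp; ring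
  have h8 := mul_le_mul_of_nonneg_left hys (show 0 ≤ 2 * r by positivity)
  rw [h5, h2] at h4
  -- The estimates combine to `2rδ ≤ -3u² + 12εu + 7ε²`, which is at most `19ε²`, with equality at
  -- `u = 2ε`.
  nlinarith [sq_nonneg (u - 2 * ε), sq_nonneg ε]

/-! ### Comparison and finiteness of intrinsic distances -/

/-- Curves in `M` are pushed to `S` by the retraction, which keeps their endpoints because these lie
on `S`. -/
theorem intrinsicEDist_le_mul {d : ℕ} {r η : ℝ} {M S : Set (EuclideanSpace ℝ (Fin d))}
    (hS : ∀ p ∈ S, ∃ T, IsTangentWithBalls r S p T) (hSc : IsCompact S) (hr : 0 < r) (hη : η < r)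
    (hMS : ∀ p ∈ M, Metric.infDist p S ≤ η) {p q : EuclideanSpace ℝ (Fin d)} (hp : p ∈ S)
    (hq : q ∈ S) :
    intrinsicEDist S p q ≤ ENNReal.ofReal (r / (r - η)) * intrinsicEDist M p q := by
  obtain ⟨π, hπ, hfix, hL⟩ := exists_lipschitzOnWith_retraction hS hSc ⟨p, hp⟩ hr.le hη
  have hK : ENNReal.ofReal (r / (r - η)) ≠ ⊤ := ENNReal.ofReal_ne_top
  rw [intrinsicEDist, intrinsicEDist]
  simp only [ENNReal.mul_iInf_of_ne (ENNReal.ofReal_pos.2 (div_pos hr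
    (sub_pos.2 hη))).ne' hK]
  refine le_iInf₂ fun γ ⟨hc, hmaps, h0, h1⟩ => ?_
  have hmaps' : MapsTo γ (Icc 0 1) {x | Metric.infDist x S ≤ η} := fun t ht => hMS _ (hmaps ht)
  refine iInf₂_le_of_le (π ∘ γ) ⟨hL.continuousOn.comp hc hmaps', fun t _ => hπ _, ?_, ?_⟩ ?_
  · rw [Function.comp_apply, h0, hfix p hp]
  · rw [Function.comp_apply, h1, hfix q hq]
  · exact hL.comp_eVariationOn_le hmaps'

/-- The straight segment stays within `r / 2` of `S`, so its projection is a curve of finite length.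
-/
theorem intrinsicEDist_ne_top_of_dist_le {d : ℕ} {r : ℝ} {S : Set (EuclideanSpace ℝ (Fin d))}
    (hS : ∀ p ∈ S, ∃ T, IsTangentWithBalls r S p T) (hSc : IsCompact S) (hr : 0 < r)
    {p q : EuclideanSpace ℝ (Fin d)} (hp : p ∈ S) (hq : q ∈ S) (hpq : dist p q ≤ r / 2) :
    intrinsicEDist S p q ≠ ⊤ := by
  have hle := intrinsicEDist_le_mul (M := segment ℝ p q) hS hSc hr (half_lt_self hr)
    (fun z hz => ?_) hp hq
  · refine ne_top_of_le_ne_top (ENNReal.mul_ne_top ENNReal.ofReal_ne_top ?_) hle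
    have hL : LipschitzWith (nndist p q) (AffineMap.lineMap p q : ℝ → EuclideanSpace ℝ (Fin d)) :=
      lipschitzWith_lineMap p q
    refine ne_top_of_le_ne_top ?_ (iInf₂_le (AffineMap.lineMap p q : ℝ → EuclideanSpace ℝ (Fin d))
      ⟨hL.continuous.continuousOn, fun t ht => ?_, by simp, by simp⟩)
    · have := (hL.lipschitzOnWith (s := univ)).comp_eVariationOn_le (g := id) (s := Icc 0 1)
        (mapsTo_univ _ _)
      rw [eVariationOn_id_Icc] at this
      exact ne_top_of_le_ne_top (ENNReal.mul_ne_top ENNReal.coe_ne_top ENNReal.ofReal_ne_top) this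
    · rw [segment_eq_image_lineMap]
      exact mem_image_of_mem _ ht
  · refine (Metric.infDist_le_dist_of_mem hp).trans (le_trans ?_ hpq)
    rw [dist_eq_norm, dist_eq_norm, norm_sub_rev p]
    exact norm_sub_le_of_mem_segment hz

theorem intrinsicEDist_ne_top_trans {d : ℕ} {S : Set (EuclideanSpace ℝ (Fin d))}
    {p q s : EuclideanSpace ℝ (Fin d)} (hpq : intrinsicEDist S p q ≠ ⊤)
    (hqs : intrinsicEDist S q s ≠ ⊤) : intrinsicEDist S p s ≠ ⊤ := by
  simp only [intrinsicEDist, ← lt_top_iff_ne_top, iInf_lt_iff] at hpq hqs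
  obtain ⟨γ, ⟨hc, hm, h0, h1⟩, hv⟩ := hpq
  obtain ⟨γ', ⟨hc', hm', h0', h1'⟩, hv'⟩ := hqs
  set f : ℝ → EuclideanSpace ℝ (Fin d) :=
    fun t => if t ≤ 1 / 2 then γ (2 * t) else γ' (2 * t - 1) with hf
  have hleft : EqOn f (γ ∘ fun t => 2 * t) (Icc 0 (1 / 2)) := fun t ht => by
    rw [hf]; simp only [ht.2, if_true, Function.comp_apply]
  have hright : EqOn f (γ' ∘ fun t => 2 * t - 1) (Icc (1 / 2) 1) := fun t ht => by
    rcases ht.1.eq_or_lt with h | h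
    · subst h; simp [hf, h1, h0']
    · rw [hf]; simp only [not_le.2 h, if_false, Function.comp_apply]
  have hmapl : MapsTo (fun t : ℝ => 2 * t) (Icc 0 (1 / 2)) (Icc 0 1) := fun t ht =>
    ⟨by linarith [ht.1], by linarith [ht.2]⟩
  have hmapr : MapsTo (fun t : ℝ => 2 * t - 1) (Icc (1 / 2) 1) (Icc 0 1) := fun t ht =>
    ⟨by linarith [ht.1], by linarith [ht.2]⟩
  have hU : Icc (0 : ℝ) (1 / 2) ∪ Icc (1 / 2) 1 = Icc 0 1 :=
    Icc_union_Icc_eq_Icc (by norm_num) (by norm_num)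
  refine ne_top_of_le_ne_top ?_ (iInf₂_le f ⟨?_, ?_, ?_, ?_⟩)
  · rw [← hU, eVariationOn.union f (isGreatest_Icc (by norm_num)) (isLeast_Icc (by norm_num)),
      eVariationOn.congr hleft, eVariationOn.congr hright]
    refine ENNReal.add_ne_top.2 ⟨?_, ?_⟩
    · exact ne_top_of_le_ne_top hv.ne (eVariationOn.comp_le_of_monotoneOn _ _
        (fun a _ b _ hab => by simpa using hab) hmapl)
    · exact ne_top_of_le_ne_top hv'.ne (eVariationOn.comp_le_of_monotoneOn _ _
        (fun a _ b _ hab => by simpa using hab) hmapr)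
  · rw [← hU]
    refine ContinuousOn.union_of_isClosed ?_ ?_ isClosed_Icc isClosed_Icc
    · exact (hc.comp (by fun_prop) hmapl).congr hleft
    · exact (hc'.comp (by fun_prop) hmapr).congr hright
  · rw [← hU]
    rintro t (ht | ht)
    · rw [hleft ht]; exact hm (hmapl ht)
    · rw [hright ht]; exact hm' (hmapr ht)
  · simp [hf, h0]
  · rw [hright ⟨by norm_num, le_rfl⟩]; norm_num [h1']

/-- Finiteness is local and transitive, so connectedness spreads it over `S`. -/
theorem intrinsicEDist_ne_top {d : ℕ} {r : ℝ} {S : Set (EuclideanSpace ℝ (Fin d))}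
    (hS : ∀ p ∈ S, ∃ T, IsTangentWithBalls r S p T) (hSc : IsCompact S) (hconn : IsPreconnected S)
    (hr : 0 < r) {p q : EuclideanSpace ℝ (Fin d)} (hp : p ∈ S) (hq : q ∈ S) :
    intrinsicEDist S p q ≠ ⊤ := by
  refine hconn.induction₂' (fun p q => intrinsicEDist S p q ≠ ⊤) (fun x hx => ?_)
    (fun _ _ _ _ _ _ => intrinsicEDist_ne_top_trans) hp hq
  filter_upwards [self_mem_nhdsWithin,
    mem_nhdsWithin_of_mem_nhds (Metric.closedBall_mem_nhds x (half_pos hr))] with y hy hyx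
  exact ⟨intrinsicEDist_ne_top_of_dist_le hS hSc hr hx hy (by rwa [dist_comm]),
    intrinsicEDist_ne_top_of_dist_le hS hSc hr hy hx hyx⟩

theorem intrinsicDist_le_mul {d : ℕ} {r η : ℝ} {M S : Set (EuclideanSpace ℝ (Fin d))}
    (hS : ∀ p ∈ S, ∃ T, IsTangentWithBalls r S p T) (hSc : IsCompact S) (hr : 0 < r)
    (hη : η ≤ r / 2) (hη0 : 0 ≤ η) (hMS : ∀ p ∈ M, Metric.infDist p S ≤ η)
    {p q : EuclideanSpace ℝ (Fin d)} (hp : p ∈ S) (hq : q ∈ S) (hfin : intrinsicEDist M p q ≠ ⊤) :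
    intrinsicDist S p q ≤ (1 + 2 * η / r) * intrinsicDist M p q := by
  have hle := intrinsicEDist_le_mul hS hSc hr (by linarith) hMS hp hq
  have hpos : 0 < r - η := by linarith
  have h1 := ENNReal.toReal_mono (ENNReal.mul_ne_top ENNReal.ofReal_ne_top hfin) hle
  rw [ENNReal.toReal_mul, ENNReal.toReal_ofReal (by positivity)] at h1
  refine h1.trans (mul_le_mul_of_nonneg_right ?_ ENNReal.toReal_nonneg)
  rw [div_le_iff₀ hpos]
  -- This is `1 / (1 - a) ≤ 1 + 2a` for `a = η / r` in `[0, 1/2]`.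
  have h2 : (1 + 2 * η / r) * (r - η) = r + η * (r - 2 * η) / r := by field_simp; ring
  rw [h2]
  have : 0 ≤ η * (r - 2 * η) / r := div_nonneg (mul_nonneg hη0 (by linarith)) hr.le
  linarith

/-! ### The main theorem -/

theorem IsReconstruction.half_reach_le {d n k : ℕ} {ε : ℝ} {M S : Set (EuclideanSpace ℝ (Fin d))}
    {x : Fin n → EuclideanSpace ℝ (Fin d)} (hS : IsReconstruction k ε x S)
    (hM : M ∈ surfaceClass k ε x) : reach M / 2 ≤ reach S := by
  have hle : reach M ≤ maxReach k ε x := le_iSup₂_of_le M hM le_rfl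
  rcases hS.2 with h | ⟨-, h⟩
  · rw [h]
    exact ENNReal.half_le_self.trans hle
  · exact (ENNReal.div_le_div_right hle 2).trans h

theorem mainTheorem1 (d k : ℕ) (M : Set (EuclideanSpace ℝ (Fin d)))
    (hM : IsClosedC2Surface k M) :
    ∃ C : ℝ, 0 < C ∧
      ∀ (n : ℕ) (x : Fin n → EuclideanSpace ℝ (Fin d)) (ε : ℝ) (S : Set (EuclideanSpace ℝ (Fin d))),
        IsNet x ε (1 / 2) M → IsReconstruction k ε x S → ε ≤ 1 / C →
          (∀ p ∈ M ∩ S, ∀ q ∈ M ∩ S,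
            intrinsicEDist M p q ≠ ⊤ ∧ intrinsicEDist S p q ≠ ⊤ ∧
            |intrinsicDist M p q - intrinsicDist S p q| ≤
              C * ε ^ 2 * min (intrinsicDist M p q) (intrinsicDist S p q)) ∧
          (∀ i j : Fin n,
            |intrinsicDist M (x i) (x j) - intrinsicDist S (x i) (x j)| ≤
              C * ε ^ 2 * min (intrinsicDist M (x i) (x j)) (intrinsicDist S (x i) (x j))) := by
  obtain ⟨r₀, hr₀, hM₀⟩ := hM.isC2Submanifold.exists_tangentWithBalls hM.isCompact
  -- Halving absorbs the loss when the maximal reach is not attained.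
  obtain ⟨r, hr, hrr⟩ : ∃ r > 0, r₀ = r * 2 := ⟨r₀ / 2, half_pos hr₀, by ring⟩
  have hMr : ∀ p ∈ M, ∃ T, IsTangentWithBalls r M p T := fun p hp => by
    obtain ⟨T, hT⟩ := hM₀ p hp
    exact ⟨T, hT.mono hr.le (by linarith)⟩
  -- The term `20 / r ^ 2` is `2η / r` divided by `ε ^ 2`; the term `5 / r` only serves to force `ε
  -- ≤ r / 5`, hence `η ≤ r / 2`.
  refine ⟨20 / r ^ 2 + 5 / r, by positivity, fun n x ε S hxM hS hε => ?_⟩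
  have hSr : ∀ p ∈ S, ∃ T, IsTangentWithBalls r S p T := by
    refine hS.1.1.isC2Submanifold.exists_tangentWithBalls_of_le_reach hS.1.1.isCompact hr.le
      (le_trans ?_ (hS.half_reach_le ⟨hM, hxM⟩))
    rw [ENNReal.le_div_iff_mul_le (by simp) (by simp)]
    refine le_trans (le_of_eq ?_) (ofReal_le_reach hM₀)
    rw [hrr, ENNReal.ofReal_mul hr.le, ENNReal.ofReal_ofNat]
  have hε0 : 0 ≤ ε := by
    obtain ⟨p, hp⟩ := hM.isConnected.nonempty
    obtain ⟨i, hi⟩ := hxM.cover p hp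
    exact dist_nonneg.trans hi
  have hεr : ε ≤ r / 5 := by
    refine hε.trans ?_
    rw [div_le_iff₀ (by positivity)]
    have : r / 5 * (20 / r ^ 2 + 5 / r) = 4 / r + 1 := by field_simp; ring
    rw [this]
    have : 0 < 4 / r := by positivity
    linarith
  have hη : 10 * ε ^ 2 / r ≤ r / 2 := by
    rw [div_le_iff₀ hr]
    nlinarith
  have hη0 : 0 ≤ 10 * ε ^ 2 / r := by positivity
  have hmain : ∀ p ∈ M ∩ S, ∀ q ∈ M ∩ S,
      intrinsicEDist M p q ≠ ⊤ ∧ intrinsicEDist S p q ≠ ⊤ ∧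
      |intrinsicDist M p q - intrinsicDist S p q| ≤
        (20 / r ^ 2 + 5 / r) * ε ^ 2 * min (intrinsicDist M p q) (intrinsicDist S p q) := by
    intro p hp q hq
    have hMfin := intrinsicEDist_ne_top hMr hM.isCompact hM.isConnected.isPreconnected hr hp.1 hq.1
    have hSfin := intrinsicEDist_ne_top hSr hS.1.1.isCompact hS.1.1.isConnected.isPreconnected hr
      hp.2 hq.2
    have h1 := intrinsicDist_le_mul hSr hS.1.1.isCompact hr hη hη0 (fun p hp =>
      infDist_le_of_common_net hr hSr hMr hS.1.1.isCompact hM.isCompact hS.1.2 hxM hp) hp.2 hq.2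
      hMfin
    have h2 := intrinsicDist_le_mul hMr hM.isCompact hr hη hη0 (fun p hp =>
      infDist_le_of_common_net hr hMr hSr hM.isCompact hS.1.1.isCompact hxM hS.1.2 hp) hp.1 hq.1
      hSfin
    refine ⟨hMfin, hSfin, ?_⟩
    have hK : 2 * (10 * ε ^ 2 / r) / r ≤ (20 / r ^ 2 + 5 / r) * ε ^ 2 := by
      rw [show 2 * (10 * ε ^ 2 / r) / r = 20 / r ^ 2 * ε ^ 2 by field_simp; ring, add_mul]
      have : 0 ≤ 5 / r * ε ^ 2 := by positivity
      linarith
    have hMd : 0 ≤ intrinsicDist M p q := ENNReal.toReal_nonneg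
    have hSd : 0 ≤ intrinsicDist S p q := ENNReal.toReal_nonneg
    have h3 := mul_le_mul_of_nonneg_right hK hMd
    have h4 := mul_le_mul_of_nonneg_right hK hSd
    have hC : 0 ≤ (20 / r ^ 2 + 5 / r) * ε ^ 2 := by positivity
    rw [abs_sub_le_iff]
    rcases le_total (intrinsicDist M p q) (intrinsicDist S p q) with h | h
    · have := mul_nonneg hC hMd
      rw [min_eq_left h]
      constructor <;> linarith
    · have := mul_nonneg hC hSd
      rw [min_eq_right h]
      constructor <;> linarith
  exact ⟨hmain, fun i j => (hmain _ ⟨hxM.mem i, hS.1.2.mem i⟩ _ ⟨hxM.mem j, hS.1.2.mem j⟩).2.2⟩
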